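/- **Setting.** Let $n\ge 1$, let $x_1,\dots,x_n$ be fixed points of a set $\mathcal X$, let $\mathcal F$ be a class of functions $\mathcal X\to\mathbb R$, and let $\mathcal C\subset\mathbb R^n$ be compact. For functions $f,g$ and a vector $v\in\mathbb R^n$ write $f(x_1^n)=(f(x_1),\dots,f(x_n))$, $\|g\|_n^2=\frac1n\sum_i g(x_i)^2$ and $\langle v,g\rangle_n=\frac1n\sum_i v_i g(x_i)$. Let $\mathcal M:\mathbb R^n\to\mathcal F$ be a constrained least-squares method: for every $y\in\mathbb R^n$, $\mathcal M(y)$ minimizes $\frac1n\sum_i(y_i-f(x_i))^2+\mathcal P(f)$ over $f\in\mathcal F$, where $\mathcal P(f)=0$ if $f(x_1^n)\in\mathcal C$ and $\mathcal P(f)=+\infty$ otherwise; assume that $y\mapsto\mathcal M(y)(x_i)$ is measurable for each $i$. Let $f^*:\mathcal X\to\mathbb R$ and $f^\dagger=\mathcal M(f^*(x_1^n))$. Assume that $\mathcal M$ is firmly non-expansive around $f^*$, i.e. for all $u\in\mathbb R^n$, $$\|\mathcal M(f^*(x_1^n)+u)-f^\dagger\|_n^2\le\langle u,\ \mathcal M(f^*(x_1^n)+u)-f^\dagger\rangle_n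 .$$ The observations are $y_i=f^*(x_i)+w_i$, where $w_1,\dots,w_n$ are independent real random variables, each with a distribution symmetric about $0$; $\varepsilon_1,\dots,\varepsilon_n$ are i.i.d. Rademacher variables independent of $w=(w_1,\dots,w_n)$. Let $\hat f=\mathcal M(y)$ and $\hat r_n=\|\hat f-f^\dagger\|_n$, let $\tilde f$ be any (possibly random) pilot function $\mathcal X\to\mathbb R$, and let $\tilde w_i=y_i-\tilde f(x_i)$. For $r\ge0$ let $\mathbb B_r(\hat f)=\{f\in\mathcal F:\|f-\hat f\|_n\le r\}$, let $$W_n(r)=\sup_{f\in\mathbb B_r(\hat f)}\frac1n\sum_{i=1}^n\varepsilon_i\tilde w_i\,(f(x_i)-\hat f(x_i))$$ be the wild noise complexity, and, for a given $t$, let the pilot error be $$A_n(\tilde f)=\sup_{f\in\mathbb B_{(2+1/t)\hat r_n}(\hat f)}\frac1n\sum_{i=1}^n\varepsilon_i\,(\tilde f(x_i)-f^*(x_i))\,(f(x_i)-\hat f(x_i)).$$ For $\rho>0$ let $\tilde r_\rho=\|\mathcal M(y^\diamond)-\hat f\|_n$ with $y_i^\diamond=\hat f(x_i)+\rho\,\varepsilon_i\tilde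 w_i$ be the error of the wild refit. **Theorem.** For every $t\ge3$ there is an event of probability at least $1-2e^{-t^2}$ on which $$\hat r_n^2\le\max\Big\{W_n\big((2+\tfrac1t)\hat r_n\big),\ \tfrac{t^4}{n}\Big\}+\frac{6\|w\|_\infty}{t}\,\hat r_n^2+A_n(\tilde f)$$ and on which, if in addition $\mathcal F$ is convex, for every $\rho>0$ with $\tilde r_\rho>0$, $$\hat r_n^2\le\max\Big\{\tilde r_\rho^{\,2},\ \frac{\hat r_n}{\tilde r_\rho}\,W_n\big((2+\tfrac1t)\tilde r_\rho\big),\ \tfrac{t^4}{n}\Big\}+\frac{6\|w\|_\infty}{t}\,\hat r_n^2+A_n(\tilde f).$$ -/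

import Mathlib

open MeasureTheory ProbabilityTheory
open scoped ENNReal

namespace WildRefit

noncomputable section

variable {X : Type*} {n : ℕ}

/-- The vector `(f (x 1), …, f (x n))` of values of `f` at the design points. -/
def evalVec (x : Fin n → X) (f : X → ℝ) : Fin n → ℝ := fun i => f (x i)

/-- The empirical inner product `(1/n) ∑ i, v i * g (x i)` of a vector with a function. -/
def empInner (x : Fin n → X) (v : Fin n → ℝ) (g : X → ℝ) : ℝ :=
  (1 / (n : ℝ)) * ∑ i, v i * g (x i)

/-- The empirical norm `√((1/n) ∑ i, g (x i) ^ 2)`. -/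
def empNorm (x : Fin n → X) (g : X → ℝ) : ℝ :=
  Real.sqrt ((1 / (n : ℝ)) * ∑ i, g (x i) ^ 2)

open Classical in
/-- The penalty that is `0` if the vector of fitted values lies in `C`, and `+∞` otherwise. -/
def constraintPenalty (x : Fin n → X) (C : Set (Fin n → ℝ)) (f : X → ℝ) : ℝ≥0∞ :=
  if evalVec x f ∈ C then 0 else ⊤

/-- The penalized least-squares objective. -/
def objective (x : Fin n → X) (P : (X → ℝ) → ℝ≥0∞) (y : Fin n → ℝ) (f : X → ℝ) : ℝ≥0∞ :=
  ENNReal.ofReal ((1 / (n : ℝ)) * ∑ i, (y i - f (x i)) ^ 2) + P f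

/-- The method `M` sends every response vector to a minimizer over `F` of the
penalized least-squares objective. -/
def IsMEstimator (x : Fin n → X) (F : Set (X → ℝ)) (P : (X → ℝ) → ℝ≥0∞)
    (M : (Fin n → ℝ) → (X → ℝ)) : Prop :=
  ∀ y, M y ∈ F ∧ IsMinOn (objective x P y) F (M y)

/-- Firm non-expansiveness of the method `M` around `fstar`. -/
def FirmlyNonexpansiveAround (x : Fin n → X) (M : (Fin n → ℝ) → (X → ℝ))
    (fstar : X → ℝ) : Prop :=
  ∀ u : Fin n → ℝ,
    empNorm x (M (evalVec x fstar + u) - M (evalVec x fstar)) ^ 2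
      ≤ empInner x u (M (evalVec x fstar + u) - M (evalVec x fstar))

/-- The ball of radius `r` around `g` in the class `F`, for the empirical norm. -/
def empBall (x : Fin n → X) (F : Set (X → ℝ)) (g : X → ℝ) (r : ℝ) : Set (X → ℝ) :=
  {f | f ∈ F ∧ empNorm x (f - g) ≤ r}

/-- The supremum of `(1/n) ∑ i, ε i * v i * (f (x i) - g (x i))` over the functions `f ∈ F`
with `‖f - g‖ₙ ≤ r`. -/
def localComplexity (x : Fin n → X) (F : Set (X → ℝ)) (g : X → ℝ) (ε v : Fin n → ℝ)
    (r : ℝ) : ℝ :=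
  sSup ((fun f : X → ℝ => empInner x (fun i => ε i * v i) (f - g)) '' empBall x F g r)

/-- The wild noise complexity at `fhat`: the supremum above for the residuals
`y i - ftil (x i)` of the pilot `ftil`. -/
def wildComplexity (x : Fin n → X) (F : Set (X → ℝ)) (y ε : Fin n → ℝ)
    (fhat ftil : X → ℝ) (r : ℝ) : ℝ :=
  localComplexity x F fhat ε (y - evalVec x ftil) r

/-- The pilot error: the supremum above for the differences `ftil (x i) - fstar (x i)`. -/
def pilotError (x : Fin n → X) (F : Set (X → ℝ)) (fstar : X → ℝ) (ε : Fin n → ℝ)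
    (fhat ftil : X → ℝ) (r : ℝ) : ℝ :=
  localComplexity x F fhat ε (evalVec x (ftil - fstar)) r

/-- The wild responses `fhat (x i) + ρ * ε i * (y i - ftil (x i))`, where `fhat = M y`. -/
def wildResponse (x : Fin n → X) (M : (Fin n → ℝ) → (X → ℝ)) (y ε : Fin n → ℝ)
    (ftil : X → ℝ) (ρ : ℝ) : Fin n → ℝ :=
  fun i => M y (x i) + ρ * ε i * (y i - ftil (x i))

/-- The error `‖M(wild responses) - M(y)‖ₙ` of the wild refit at noise scale `ρ`. -/
def wildError (x : Fin n → X) (M : (Fin n → ℝ) → (X → ℝ)) (y ε : Fin n → ℝ)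
    (ftil : X → ℝ) (ρ : ℝ) : ℝ :=
  empNorm x (M (wildResponse x M y ε ftil ρ) - M y)

/-- The error `‖M(y) - f†‖ₙ`, where `f† = M(fstar(x₁), …, fstar(xₙ))` is the
fit to the noiseless responses. -/
def estError (x : Fin n → X) (M : (Fin n → ℝ) → (X → ℝ)) (fstar : X → ℝ)
    (y : Fin n → ℝ) : ℝ :=
  empNorm x (M y - M (evalVec x fstar))

/-- The real random variables `w i` are independent, each with a symmetric distribution. -/
structure IsSymmetricNoise {Ω : Type*} [MeasurableSpace Ω] (μ : Measure Ω)
    (w : Fin n → Ω → ℝ) : Prop where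
  measurable : ∀ i, Measurable (w i)
  indep : iIndepFun w μ
  symm : ∀ i, IdentDistrib (w i) (fun ω => -w i ω) μ μ

/-- The `ε i` are i.i.d. Rademacher variables. -/
structure IsRademacherSeq {Ω : Type*} [MeasurableSpace Ω] (μ : Measure Ω)
    (ε : Fin n → Ω → ℝ) : Prop where
  measurable : ∀ i, Measurable (ε i)
  indep : iIndepFun ε μ
  prob_one : ∀ i, μ {ω | ε i ω = 1} = 1 / 2
  prob_neg_one : ∀ i, μ {ω | ε i ω = -1} = 1 / 2

end

end WildRefit

/-! Firm non-expansiveness at `u = w` bounds `rhat ^ 2` by the noise correlation with `M y - f†`,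
hence by the supremum of the noise process over a ball around the deterministic centre `f†`. Fix the
absolute values of the noise: its signs `σ` and the products `τ * σ` with the Rademacher signs are
two independent uniform sign vectors, so the noise supremum and its wild version are independent
copies of one Rademacher supremum.

An infimum-convolution inequality on the hypercube, `sum_exp_iSup_mul_sum_exp_neg_iSup_le`, bounds
`E exp(Q f) * E exp(-f)` by one, and so compares two independent copies directly, without passing
through the mean; this gives the tail `exp(-q ^ 2 / 8)` of `card_iSup_deviation_le`. Peeling over a
geometric grid of radii makes the comparison uniform, so that the random radius `rhat` may be used.

It remains to recentre at `M y`. A ball of radius `(1 + 1/t) * rhat` around `f†` lies in the ball of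
radius `(2 + 1/t) * rhat` around `M y`; the cross term pairs the signs with a function of the noise
alone and has a sub-Gaussian tail; and `w` splits into the pilot residual plus the pilot's error.
The two deviations cost `4‖w‖/t` and `2‖w‖/t` times `rhat ^ 2`. For convex `F`, the supremum divided
by its radius is nonincreasing, which allows `rwild` to replace `rhat` when it is smaller. -/

namespace WildRefit

/-! ### Infimum convolution on the hypercube -/

/-- The real vector of a sign vector. -/
def signVec {n : ℕ} (σ : Fin n → ℤˣ) : Fin n → ℝ := fun j => ((σ j : ℤ) : ℝ)

/-- The scalar core of the one-coordinate step, with the interpolation parameter already at its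
optimum `min u 1`. Equality holds at `u = 0`, and the expansion there agrees with `4` through second
order. -/
theorem exp_two_point_le {u : ℝ} (hu : 0 ≤ u) :
    (Real.exp ((min u 1) ^ 2 / 2 - min u 1 * u) + Real.exp (-u)) * (1 + Real.exp u) ≤ 4 := by
  have hm : Real.exp (-u) * Real.exp u = 1 := by rw [← Real.exp_add]; simp
  rcases le_total u 1 with h | h
  · rw [min_eq_left h]
    have e1 : Real.exp (u ^ 2 / 2 - u * u) * (1 + u ^ 2 / 2) ≤ 1 := by
      have h1 : u ^ 2 / 2 + 1 ≤ Real.exp (u ^ 2 / 2) := Real.add_one_le_exp _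
      have h2 : Real.exp (u ^ 2 / 2 - u * u) * Real.exp (u ^ 2 / 2) = 1 := by
        rw [← Real.exp_add]; ring_nf; simp
      nlinarith [Real.exp_pos (u ^ 2 / 2 - u * u)]
    have e2 : Real.exp u ≤ 1 + u + u ^ 2 / 2 + u ^ 3 / 6 + u ^ 4 * (5 / 96) := by
      have := Real.exp_bound' hu h (n := 4) (by norm_num)
      simp [Finset.sum_range_succ, Nat.factorial] at this
      nlinarith
    have e3 : Real.exp (-u) ≤ 1 - u + u ^ 2 / 2 - u ^ 3 / 6 + u ^ 4 * (5 / 96) := by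
      have := Real.exp_bound (x := -u) (by rw [abs_neg, abs_of_nonneg hu]; exact h) (n := 4)
        (by norm_num)
      simp [Finset.sum_range_succ, Nat.factorial, abs_of_nonneg hu] at this
      have := (abs_le.1 this).2
      nlinarith
    set a := Real.exp (u ^ 2 / 2 - u * u)
    have ha : 0 < a := Real.exp_pos _
    have key : 1 + Real.exp u ≤ (1 + u ^ 2 / 2) * (3 - Real.exp (-u)) := by
      have h4 : (1 + u ^ 2 / 2) * (2 + u - u ^ 2 / 2 + u ^ 3 / 6 - u ^ 4 * (5 / 96))
          ≤ (1 + u ^ 2 / 2) * (3 - Real.exp (-u)) :=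
        mul_le_mul_of_nonneg_left (by linarith) (by positivity)
      -- The exact difference of the two polynomial bounds: everything below the cubic term cancels.
      have : 0 ≤ u ^ 3 * (1 / 2 - u * (1 / 4 + 10 / 96) + u ^ 2 / 12 - u ^ 3 * (5 / 192)) := by
        apply mul_nonneg (by positivity)
        nlinarith [pow_nonneg hu 2]
      nlinarith
    have h3 : 0 ≤ 3 - Real.exp (-u) := by
      have : Real.exp (-u) ≤ 1 := Real.exp_le_one_iff.2 (by linarith)
      linarith
    have : a * (1 + Real.exp u) ≤ 3 - Real.exp (-u) := by
      calc a * (1 + Real.exp u) ≤ a * ((1 + u ^ 2 / 2) * (3 - Real.exp (-u))) := by gcongr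
        _ = (a * (1 + u ^ 2 / 2)) * (3 - Real.exp (-u)) := by ring
        _ ≤ 1 * (3 - Real.exp (-u)) := by gcongr
        _ = _ := one_mul _
    nlinarith
  · rw [min_eq_right h]
    have e0 : Real.exp (1 ^ 2 / 2 - 1 * u) = Real.exp (1 / 2) * Real.exp (-u) := by
      rw [← Real.exp_add]; ring_nf
    have e1 : Real.exp (1 / 2) ≤ 1.65 := by
      have := Real.exp_bound' (x := 1 / 2) (by norm_num) (by norm_num) (n := 4) (by norm_num)
      norm_num [Finset.sum_range_succ, Nat.factorial] at this
      linarith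
    have e2 : Real.exp (-u) ≤ 0.4 := by
      have h1 : Real.exp (-u) ≤ Real.exp (-1) := Real.exp_le_exp.2 (by linarith)
      have := Real.exp_neg_one_lt_d9
      linarith
    rw [e0]
    nlinarith [Real.exp_pos (-u), Real.exp_pos (1 / 2)]

/-- Hölder's inequality, obtained from convexity of `exp` after normalizing both sums to one. -/
theorem sum_exp_convex_comb_le {ι : Type*} [Fintype ι] [Nonempty ι] (B₁ B₂ : ι → ℝ) {θ : ℝ}
    (h0 : 0 ≤ θ) (h1 : θ ≤ 1) :
    ∑ i, Real.exp ((1 - θ) * B₁ i + θ * B₂ i) ≤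
      Real.exp ((1 - θ) * Real.log (∑ i, Real.exp (B₁ i))
        + θ * Real.log (∑ i, Real.exp (B₂ i))) := by
  set S₁ := ∑ i, Real.exp (B₁ i)
  set S₂ := ∑ i, Real.exp (B₂ i)
  have p1 : 0 < S₁ := Finset.sum_pos (fun i _ => Real.exp_pos _) Finset.univ_nonempty
  have p2 : 0 < S₂ := Finset.sum_pos (fun i _ => Real.exp_pos _) Finset.univ_nonempty
  set c := (1 - θ) * Real.log S₁ + θ * Real.log S₂
  have hi : ∀ i, Real.exp ((1 - θ) * B₁ i + θ * B₂ i) ≤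
      Real.exp c * ((1 - θ) * (Real.exp (B₁ i) / S₁) + θ * (Real.exp (B₂ i) / S₂)) := by
    intro i
    have := convexOn_exp.2 (Set.mem_univ (B₁ i - Real.log S₁)) (Set.mem_univ (B₂ i - Real.log S₂))
      (sub_nonneg.2 h1) h0 (by ring)
    simp only [smul_eq_mul, Real.exp_sub, Real.exp_log p1, Real.exp_log p2] at this
    calc Real.exp ((1 - θ) * B₁ i + θ * B₂ i) = Real.exp c *
        Real.exp ((1 - θ) * (B₁ i - Real.log S₁) + θ * (B₂ i - Real.log S₂)) := by
          rw [← Real.exp_add]; congr 1; simp only [c]; ring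
      _ ≤ _ := by gcongr
  refine (Finset.sum_le_sum fun i _ => hi i).trans_eq ?_
  rw [← Finset.mul_sum, Finset.sum_add_distrib, ← Finset.mul_sum, ← Finset.mul_sum,
    ← Finset.sum_div, ← Finset.sum_div, div_self p1.ne', div_self p2.ne']
  ring

/-- Indices stand for the two faces of the cube. The induction hypothesis controls each face by `p *
N₁` and `q * N₂`. On the face with the smaller `N` it pays to interpolate towards the other face; on
the other face no interpolation is needed. -/
theorem two_point_product_le_of_le {K p q a b N₁ N₂ : ℝ} (hp : 0 < p) (hq : 0 < q)
    (h₁ : 0 < N₁) (h₂ : 0 < N₂) (hpN : p * N₁ ≤ K) (hqN : q * N₂ ≤ K)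
    (ha : ∀ θ, 0 ≤ θ → θ ≤ 1 →
      a ≤ Real.exp (θ ^ 2 / 2 + ((1 - θ) * Real.log p + θ * Real.log q)))
    (hb : b ≤ q) (hN : N₁ ≤ N₂) : (a + b) * (N₁ + N₂) ≤ 4 * K := by
  have hK : 0 < K := (mul_pos hp h₁).trans_le hpN
  set u := Real.log N₂ - Real.log N₁ with hu
  have hu0 : 0 ≤ u := sub_nonneg.2 (Real.log_le_log h₁ hN)
  have hNu : N₂ = N₁ * Real.exp u := by
    rw [hu, Real.exp_sub, Real.exp_log h₁, Real.exp_log h₂]; field_simp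
  have lp : Real.log p ≤ Real.log (K / N₁) := Real.log_le_log hp ((le_div_iff₀ h₁).2 hpN)
  have lq : Real.log q ≤ Real.log (K / N₁) - u := by
    have := Real.log_le_log hq ((le_div_iff₀ h₂).2 hqN)
    rw [Real.log_div hK.ne' h₂.ne'] at this
    rw [Real.log_div hK.ne' h₁.ne']
    linarith
  -- The minimizer of `θ ^ 2 / 2 - θ * u` over `[0, 1]`.
  set θ := min u 1 with hθ
  have t0 : 0 ≤ θ := le_min hu0 zero_le_one
  have t1 : θ ≤ 1 := min_le_right _ _
  have ha' : a ≤ K / N₁ * Real.exp (θ ^ 2 / 2 - θ * u) := by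
    refine (ha θ t0 t1).trans ?_
    rw [← Real.exp_log (div_pos hK h₁), ← Real.exp_add, Real.exp_le_exp]
    nlinarith [mul_le_mul_of_nonneg_left lp (sub_nonneg.2 t1), mul_le_mul_of_nonneg_left lq t0]
  have hb' : b ≤ K / N₁ * Real.exp (-u) := by
    refine hb.trans ((le_div_iff₀ h₂).2 hqN |>.trans_eq ?_)
    rw [hNu, Real.exp_neg]; field_simp
  calc (a + b) * (N₁ + N₂)
      ≤ (K / N₁ * Real.exp (θ ^ 2 / 2 - θ * u) + K / N₁ * Real.exp (-u)) * (N₁ + N₂) := by gcongr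
    _ = K * ((Real.exp (θ ^ 2 / 2 - θ * u) + Real.exp (-u)) * (1 + Real.exp u)) := by
        rw [hNu]; field_simp
    _ ≤ K * 4 := by gcongr; exact exp_two_point_le hu0
    _ = 4 * K := mul_comm _ _

theorem two_point_product_le {K p q a b N₁ N₂ : ℝ} (hp : 0 < p) (hq : 0 < q)
    (h₁ : 0 < N₁) (h₂ : 0 < N₂) (hpN : p * N₁ ≤ K) (hqN : q * N₂ ≤ K)
    (ha : ∀ θ, 0 ≤ θ → θ ≤ 1 →
      a ≤ Real.exp (θ ^ 2 / 2 + ((1 - θ) * Real.log p + θ * Real.log q)))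
    (hb : ∀ θ, 0 ≤ θ → θ ≤ 1 →
      b ≤ Real.exp (θ ^ 2 / 2 + ((1 - θ) * Real.log q + θ * Real.log p))) :
    (a + b) * (N₁ + N₂) ≤ 4 * K := by
  have ha0 := ha 0 le_rfl zero_le_one
  have hb0 := hb 0 le_rfl zero_le_one
  simp [Real.exp_log hp, Real.exp_log hq] at ha0 hb0
  rcases le_total N₁ N₂ with h | h
  · exact two_point_product_le_of_le hp hq h₁ h₂ hpN hqN ha hb0 h
  · rw [add_comm a, add_comm N₁]
    exact two_point_product_le_of_le hq hp h₂ h₁ hqN hpN hb ha0 h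

theorem sum_signs_succ {n : ℕ} (g : (Fin (n + 1) → ℤˣ) → ℝ) :
    ∑ σ, g σ = ∑ σ : Fin n → ℤˣ, g (Fin.cons 1 σ) + ∑ σ : Fin n → ℤˣ, g (Fin.cons (-1) σ) := by
  rw [← (Fin.consEquiv fun _ => ℤˣ).sum_comp, Fintype.sum_prod_type]
  simp [UnitsInt.univ, Fin.consEquiv]

theorem sum_signVec_cons {n : ℕ} (s : ℤˣ) (σ : Fin n → ℤˣ) (v : Fin (n + 1) → ℝ) :
    ∑ j, signVec (Fin.cons s σ : Fin (n + 1) → ℤˣ) j * v j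
      = ((s : ℤ) : ℝ) * v 0 + ∑ j : Fin n, signVec σ j * v j.succ := by
  simp [signVec, Fin.sum_univ_succ]

/-- Infimum-convolution inequality of Maurey type for suprema of affine functions
on the hypercube. -/
theorem sum_exp_iSup_mul_sum_exp_neg_iSup_le {ι : Type*} [Nonempty ι] {n : ℕ}
    (v : ι → Fin n → ℝ) (b : ι → ℝ)
    (hbdd : ∀ σ : Fin n → ℤˣ, BddAbove (Set.range fun i => ∑ j, signVec σ j * v i j + b i)) :
    (∑ σ : Fin n → ℤˣ,
        Real.exp (⨆ i, (∑ j, signVec σ j * v i j + b i - 2 * ∑ j, v i j ^ 2))) *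
      (∑ τ : Fin n → ℤˣ, Real.exp (-⨆ i, (∑ j, signVec τ j * v i j + b i))) ≤ 4 ^ n := by
  induction n generalizing b with
  | zero => simp [← Real.exp_add]
  | succ n ih =>
    -- Once the first sign is fixed to `s`, its term joins the constant `b i`; this is why the
    -- induction runs over affine functions.
    have hbdd' : ∀ (s : ℤˣ) (σ : Fin n → ℤˣ), BddAbove (Set.range fun i =>
        ∑ j : Fin n, signVec σ j * v i j.succ + (((s : ℤ) : ℝ) * v i 0 + b i)) := by
      intro s σ
      have := hbdd (Fin.cons s σ)
      simp only [sum_signVec_cons] at this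
      convert this using 3
      ring
    set B : ℤˣ → (Fin n → ℤˣ) → ℝ := fun s σ => ⨆ i, (∑ j : Fin n, signVec σ j * v i j.succ +
      (((s : ℤ) : ℝ) * v i 0 + b i) - 2 * ∑ j : Fin n, v i j.succ ^ 2) with hB
    have hBle : ∀ (s : ℤˣ) (σ : Fin n → ℤˣ) (i : ι), ∑ j : Fin n, signVec σ j * v i j.succ +
      (((s : ℤ) : ℝ) * v i 0 + b i) - 2 * ∑ j : Fin n, v i j.succ ^ 2 ≤ B s σ := by
      intro s σ i
      refine le_ciSup (f := fun i => ∑ j : Fin n, signVec σ j * v i j.succ +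
        (((s : ℤ) : ℝ) * v i 0 + b i) - 2 * ∑ j : Fin n, v i j.succ ^ 2) ?_ i
      obtain ⟨c, hc⟩ := hbdd' s σ
      refine ⟨c, ?_⟩
      rintro _ ⟨i, rfl⟩
      have := hc ⟨i, rfl⟩
      have h0 : 0 ≤ ∑ j : Fin n, v i j.succ ^ 2 := by positivity
      dsimp only at this ⊢
      linarith
    have ih' := fun s : ℤˣ => ih (fun i j => v i j.succ) (fun i => ((s : ℤ) : ℝ) * v i 0 + b i)
      (hbdd' s)
    have hpos : ∀ g : (Fin n → ℤˣ) → ℝ, 0 < ∑ σ, Real.exp (g σ) := fun g =>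
      Finset.sum_pos (fun i _ => Real.exp_pos _) Finset.univ_nonempty
    have hN : ∀ (s : ℤˣ), (∑ τ : Fin n → ℤˣ, Real.exp (-⨆ i,
        (∑ j, signVec (Fin.cons s τ : Fin (n + 1) → ℤˣ) j * v i j + b i)))
        = ∑ τ : Fin n → ℤˣ, Real.exp (-⨆ i, (∑ j : Fin n, signVec τ j * v i j.succ
          + (((s : ℤ) : ℝ) * v i 0 + b i))) := by
      intro s
      refine Finset.sum_congr rfl fun τ _ => ?_
      congr 2; refine iSup_congr fun i => ?_; rw [sum_signVec_cons]; ring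
    have hA : ∀ (s : ℤˣ) (θ : ℝ), 0 ≤ θ → θ ≤ 1 →
        (∑ σ : Fin n → ℤˣ, Real.exp (⨆ i, (∑ j, signVec (Fin.cons s σ : Fin (n + 1) → ℤˣ) j * v i j
          + b i - 2 * ∑ j, v i j ^ 2))) ≤
        Real.exp (θ ^ 2 / 2 + ((1 - θ) * Real.log (∑ σ, Real.exp (B s σ))
          + θ * Real.log (∑ σ, Real.exp (B (-s) σ)))) := by
      intro s θ h0 h1
      rw [Real.exp_add]
      refine le_trans ?_ (mul_le_mul_of_nonneg_left
        (sum_exp_convex_comb_le (B s) (B (-s)) h0 h1) (Real.exp_pos _).le)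
      rw [Finset.mul_sum]
      refine Finset.sum_le_sum fun σ _ => ?_
      rw [← Real.exp_add, Real.exp_le_exp]
      refine ciSup_le fun i => ?_
      have e1 := mul_le_mul_of_nonneg_left (hBle s σ i) (sub_nonneg.2 h1)
      have e2 := mul_le_mul_of_nonneg_left (hBle (-s) σ i) h0
      rw [sum_signVec_cons, Fin.sum_univ_succ (fun j => v i j ^ 2)]
      push_cast at e2 ⊢
      have hs : ((s : ℤ) : ℝ) ^ 2 = 1 := by
        rcases Int.units_eq_one_or s with rfl | rfl <;> simp
      have hv : ((s : ℤ) : ℝ) ^ 2 * v i 0 ^ 2 = v i 0 ^ 2 := by rw [hs, one_mul]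
      -- Mixing the faces changes `s * v i 0` into `(1 - 2 * θ) * s * v i 0`; completing the square
      -- absorbs the difference in `2 * v i 0 ^ 2 + θ ^ 2 / 2`.
      nlinarith [sq_nonneg (θ - 2 * ((s : ℤ) : ℝ) * v i 0)]
    rw [sum_signs_succ, sum_signs_succ (fun τ => Real.exp (-⨆ i, _)), hN, hN, pow_succ, mul_comm (4 ^ n)]
    exact two_point_product_le (hpos _) (hpos _) (hpos _) (hpos _) (ih' 1) (ih' (-1))
      (fun θ h0 h1 => hA 1 θ h0 h1) (fun θ h0 h1 => by simpa only [neg_neg] using hA (-1) θ h0 h1)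

end WildRefit

/-! ### Counting sign vectors with large deviations -/

namespace WildRefit

theorem signVec_mul_self {n : ℕ} (σ : Fin n → ℤˣ) (j : Fin n) :
    signVec σ j * signVec σ j = 1 := by
  rcases Int.units_eq_one_or (σ j) with h | h <;> simp [signVec, h]

theorem signVec_mul {n : ℕ} (σ τ : Fin n → ℤˣ) (j : Fin n) :
    signVec (σ * τ) j = signVec σ j * signVec τ j := by
  simp [signVec]

theorem sum_signVec_mul_le {n : ℕ} (σ : Fin n → ℤˣ) (v : Fin n → ℝ) {L : ℝ}
    (hv : ∑ j, v j ^ 2 ≤ L ^ 2) : ∑ j, signVec σ j * v j ≤ n + L ^ 2 := by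
  have : ∀ j, signVec σ j * v j ≤ 1 + v j ^ 2 := fun j => by
    nlinarith [signVec_mul_self σ j, sq_nonneg (signVec σ j - v j), sq_nonneg (v j)]
  calc _ ≤ ∑ j, (1 + v j ^ 2) := Finset.sum_le_sum fun j _ => this j
    _ = n + ∑ j, v j ^ 2 := by simp [Finset.sum_add_distrib]
    _ ≤ _ := by linarith

theorem card_filter_le_of_sum_exp_le {α : Type*} [Fintype α] (g : α → ℝ) (a K : ℝ)
    [DecidablePred fun p => a < g p] (h : ∑ p, Real.exp (g p) ≤ K) :
    ((Finset.univ.filter fun p => a < g p).card : ℝ) ≤ K * Real.exp (-a) := by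
  have h1 : ((Finset.univ.filter fun p => a < g p).card : ℝ) * Real.exp a ≤ K := by
    refine le_trans ?_ h
    rw [← nsmul_eq_mul]
    refine (Finset.card_nsmul_le_sum _ _ _ fun p hp => ?_).trans
      (Finset.sum_le_sum_of_subset_of_nonneg (Finset.filter_subset _ _)
        fun p _ _ => (Real.exp_pos _).le)
    exact Real.exp_le_exp.2 (Finset.mem_filter.1 hp).2.le
  rw [Real.exp_neg, ← div_eq_mul_inv, le_div_iff₀ (Real.exp_pos _)]
  exact h1

/-- Deviation of the supremum of a Rademacher process above an independent copy. -/
theorem card_iSup_deviation_le {ι : Type*} [Nonempty ι] {n : ℕ} (v : ι → Fin n → ℝ)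
    {L q : ℝ} (hL : 0 ≤ L) (hq : 0 < q) (hv : ∀ i, ∑ j, v i j ^ 2 ≤ L ^ 2)
    (P : (Fin n → ℤˣ) × (Fin n → ℤˣ) → Prop) [DecidablePred P]
    (hP : ∀ p, P p → (⨆ i, ∑ j, signVec p.2 j * v i j) + q * L
      < ⨆ i, ∑ j, signVec p.1 j * v i j) :
    ((Finset.univ.filter P).card : ℝ) ≤ 4 ^ n * Real.exp (-(q ^ 2 / 8)) := by
  classical
  rcases hL.eq_or_lt with rfl | hL
  · have hv0 : ∀ i j, v i j = 0 := by
      intro i j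
      have h1 := Finset.single_le_sum (f := fun j => v i j ^ 2) (fun j _ => sq_nonneg _)
        (Finset.mem_univ j)
      have h2 := hv i
      have : v i j ^ 2 ≤ 0 := by simpa using h1.trans h2
      nlinarith
    have : Finset.univ.filter P = ∅ := by
      refine Finset.filter_eq_empty_iff.2 fun p _ hp => ?_
      have := hP p hp
      simp [hv0] at this
    rw [this]
    simp only [Finset.card_empty, Nat.cast_zero]
    positivity
  -- Minimizes the exponent `2 * l ^ 2 * L ^ 2 - l * q * L`; division by `L` is why `L = 0` was
  -- treated apart.
  set l := q / (4 * L) with hl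
  have hl0 : 0 < l := by positivity
  have hlL : l * (q * L) = q ^ 2 / 4 := by rw [hl]; field_simp
  have hlL2 : 2 * l ^ 2 * L ^ 2 = q ^ 2 / 8 := by rw [hl]; field_simp; norm_num
  set Z : (Fin n → ℤˣ) → ℝ := fun σ => ⨆ i, ∑ j, signVec σ j * v i j with hZ
  have hmul : ∀ σ i, ∑ j, signVec σ j * (l * v i j) + 0 = l * ∑ j, signVec σ j * v i j := by
    intro σ i
    rw [Finset.mul_sum, add_zero]
    exact Finset.sum_congr rfl fun j _ => by ring
  have hZmul : ∀ σ, ⨆ i, (∑ j, signVec σ j * (l * v i j) + 0) = l * Z σ := by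
    intro σ
    simp only [hmul]
    exact (Real.mul_iSup_of_nonneg hl0.le _).symm
  have hb : ∀ σ : Fin n → ℤˣ,
      BddAbove (Set.range fun i => ∑ j, signVec σ j * (l * v i j) + 0) := by
    intro σ
    refine ⟨l * (n + L ^ 2), ?_⟩
    rintro _ ⟨i, rfl⟩
    dsimp only
    rw [hmul]
    exact mul_le_mul_of_nonneg_left (sum_signVec_mul_le σ _ (hv i)) hl0.le
  have key := sum_exp_iSup_mul_sum_exp_neg_iSup_le (fun i j => l * v i j) (fun _ => 0) hb
  have hlow : ∀ σ, l * Z σ - q ^ 2 / 8 ≤ ⨆ i, (∑ j, signVec σ j * (l * v i j) + 0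
      - 2 * ∑ j, (l * v i j) ^ 2) := by
    intro σ
    have hb' : BddAbove (Set.range fun i => ∑ j, signVec σ j * (l * v i j) + 0
        - 2 * ∑ j, (l * v i j) ^ 2) := by
      obtain ⟨c, hc⟩ := hb σ
      refine ⟨c, ?_⟩
      rintro _ ⟨i, rfl⟩
      have h1 := hc ⟨i, rfl⟩
      have h0 : 0 ≤ ∑ j, (l * v i j) ^ 2 := by positivity
      dsimp only at h1 ⊢
      linarith
    rw [sub_le_iff_le_add, ← hZmul]
    refine ciSup_le fun i => ?_
    have h1 := le_ciSup hb' i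
    have h2 : 2 * ∑ j, (l * v i j) ^ 2 ≤ q ^ 2 / 8 := by
      rw [← hlL2]
      simp only [mul_pow, ← Finset.mul_sum]
      rw [← mul_assoc]
      exact mul_le_mul_of_nonneg_left (hv i) (by positivity)
    linarith
  have hsum : ∑ p : (Fin n → ℤˣ) × (Fin n → ℤˣ), Real.exp (l * Z p.1 - l * Z p.2)
      ≤ 4 ^ n * Real.exp (q ^ 2 / 8) := by
    have e : ∑ p : (Fin n → ℤˣ) × (Fin n → ℤˣ), Real.exp (l * Z p.1 - l * Z p.2)
        = Real.exp (q ^ 2 / 8) * ((∑ σ, Real.exp (l * Z σ - q ^ 2 / 8)) *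
          ∑ τ, Real.exp (-(l * Z τ))) := by
      rw [Finset.sum_mul_sum, Fintype.sum_prod_type, Finset.mul_sum]
      refine Finset.sum_congr rfl fun σ _ => ?_
      rw [Finset.mul_sum]
      refine Finset.sum_congr rfl fun τ _ => ?_
      rw [← Real.exp_add, ← Real.exp_add]
      ring_nf
    rw [e, mul_comm]
    refine mul_le_mul_of_nonneg_right (le_trans ?_ key) (Real.exp_pos _).le
    simp only [hZmul]
    exact mul_le_mul_of_nonneg_right
      (Finset.sum_le_sum fun σ _ => Real.exp_le_exp.2 (hlow σ)) (by positivity)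
  have hcard := card_filter_le_of_sum_exp_le (fun p : (Fin n → ℤˣ) × (Fin n → ℤˣ) =>
    l * Z p.1 - l * Z p.2) (q ^ 2 / 4) _ hsum
  have hsub : ((Finset.univ.filter P).card : ℝ) ≤
      (Finset.univ.filter fun p : (Fin n → ℤˣ) × (Fin n → ℤˣ) =>
        q ^ 2 / 4 < l * Z p.1 - l * Z p.2).card := by
    exact_mod_cast Finset.card_le_card (Finset.monotone_filter_right _ fun p _ hp => by
      have := mul_lt_mul_of_pos_left (hP p hp) hl0
      rw [mul_add, hlL] at this
      simp only [hZ]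
      linarith)
  refine (hsub.trans hcard).trans_eq ?_
  rw [mul_assoc, ← Real.exp_add]
  ring_nf

/-- Tail of a Rademacher sum. -/
theorem card_signVec_sum_le {n : ℕ} (v : Fin n → ℝ) {L t : ℝ} (hL : 0 ≤ L) (ht : 0 < t)
    (hv : ∑ j, v j ^ 2 ≤ L ^ 2) (P : (Fin n → ℤˣ) → Prop) [DecidablePred P]
    (hP : ∀ τ, P τ → 2 * t * L < ∑ j, signVec τ j * v j) :
    ((Finset.univ.filter P).card : ℝ) ≤ 2 ^ n * Real.exp (-t ^ 2) := by
  classical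
  rcases hL.eq_or_lt with rfl | hL
  · have hv0 : ∀ j, v j = 0 := by
      intro j
      have h1 := Finset.single_le_sum (f := fun j => v j ^ 2) (fun j _ => sq_nonneg _)
        (Finset.mem_univ j)
      have : v j ^ 2 ≤ 0 := by simpa using h1.trans hv
      nlinarith
    have : Finset.univ.filter P = ∅ := by
      refine Finset.filter_eq_empty_iff.2 fun p _ hp => ?_
      have := hP p hp
      simp [hv0] at this
    rw [this]
    simp only [Finset.card_empty, Nat.cast_zero]
    positivity
  set l := t / L with hl
  have hl0 : 0 < l := by positivity
  have hlL : l * (2 * t * L) = 2 * t ^ 2 := by rw [hl]; field_simp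
  have hlL2 : l ^ 2 * L ^ 2 = t ^ 2 := by rw [hl]; field_simp
  set Z : (Fin n → ℤˣ) → ℝ := fun σ => l * ∑ j, signVec σ j * v j with hZ
  have hmul : ∀ σ, ∑ j, signVec σ j * (l * v j) = Z σ := by
    intro σ
    simp only [hZ, Finset.mul_sum]
    exact Finset.sum_congr rfl fun j _ => by ring
  have key := sum_exp_iSup_mul_sum_exp_neg_iSup_le (ι := Unit) (fun _ j => l * v j) (fun _ => 0)
    (fun σ => Set.Finite.bddAbove (Set.finite_range _))
  simp only [ciSup_const, hmul, add_zero] at key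
  -- For a single linear function the two factors agree up to the penalty, so the product inequality
  -- bounds the square of the moment generating sum.
  have hneg : ∑ τ, Real.exp (-Z τ) = ∑ τ, Real.exp (Z τ) := by
    rw [← Equiv.sum_comp (Equiv.neg (Fin n → ℤˣ)) fun τ => Real.exp (-Z τ)]
    simp [hZ, signVec]
  have hlow : 2 * ∑ j, (l * v j) ^ 2 ≤ 2 * t ^ 2 := by
    rw [← hlL2]
    simp only [mul_pow, ← Finset.mul_sum]
    gcongr
  have hsum : ∑ τ, Real.exp (Z τ) ≤ 2 ^ n * Real.exp (t ^ 2) := by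
    refine abs_le_of_sq_le_sq' ?_ (by positivity) |>.2
    have e : (∑ τ, Real.exp (Z τ)) ^ 2 = Real.exp (2 * t ^ 2) *
        ((∑ σ, Real.exp (Z σ - 2 * t ^ 2)) * ∑ τ, Real.exp (-Z τ)) := by
      rw [hneg]
      simp only [Real.exp_sub, ← Finset.sum_div]
      field_simp
    have e2 : ((2 : ℝ) ^ n * Real.exp (t ^ 2)) ^ 2 = Real.exp (2 * t ^ 2) * 4 ^ n := by
      rw [mul_pow, ← pow_mul, mul_comm n 2, pow_mul, two_mul (t ^ 2), Real.exp_add]; norm_num; ring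
    rw [e, e2]
    refine mul_le_mul_of_nonneg_left (le_trans ?_ key) (Real.exp_pos _).le
    refine mul_le_mul_of_nonneg_right
      (Finset.sum_le_sum fun σ _ => Real.exp_le_exp.2 ?_) (by positivity)
    linarith
  have hcard := card_filter_le_of_sum_exp_le Z (2 * t ^ 2) _ hsum
  have hsub : ((Finset.univ.filter P).card : ℝ) ≤
      (Finset.univ.filter fun τ => 2 * t ^ 2 < Z τ).card := by
    exact_mod_cast Finset.card_le_card (Finset.monotone_filter_right _ fun p _ hp => by
      have := mul_lt_mul_of_pos_left (hP p hp) hl0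
      rwa [hlL] at this)
  refine (hsub.trans hcard).trans_eq ?_
  rw [mul_assoc, ← Real.exp_add]
  ring_nf

end WildRefit

/-! ### From noise and Rademacher variables to uniform sign vectors -/

namespace WildRefit

variable {n : ℕ} {Ω : Type*} [MeasurableSpace Ω] {μ : Measure Ω} {w ε : Fin n → Ω → ℝ}

theorem IsSymmetricNoise.identDistrib_sign_mul (hw : IsSymmetricNoise μ w) (σ : Fin n → ℤˣ) :
    IdentDistrib (fun ω i => w i ω) (fun ω i => signVec σ i * w i ω) μ μ := by
  refine IdentDistrib.pi (Y := fun i ω => signVec σ i * w i ω) (fun i => ?_) hw.indep ?_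
  · rcases Int.units_eq_one_or (σ i) with h | h
    · simpa [signVec, h] using IdentDistrib.refl (hw.measurable i).aemeasurable
    · simpa [signVec, h] using hw.symm i
  · exact hw.indep.comp (fun i a => signVec σ i * a) fun i => measurable_const_mul _

theorem IsRademacherSeq.ae_exists_signVec [IsProbabilityMeasure μ] (hε : IsRademacherSeq μ ε) :
    ∀ᵐ ω ∂μ, ∃ τ : Fin n → ℤˣ, (fun i => ε i ω) = signVec τ := by
  have h : ∀ i, ∀ᵐ ω ∂μ, ε i ω = 1 ∨ ε i ω = -1 := by
    intro i
    have m1 : MeasurableSet {ω | ε i ω = 1} := hε.measurable i (measurableSet_singleton 1)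
    have m2 : MeasurableSet {ω | ε i ω = -1} := hε.measurable i (measurableSet_singleton (-1))
    refine (prob_compl_eq_zero_iff (m1.union m2)).2 ?_
    rw [measure_union ?_ m2, hε.prob_one, hε.prob_neg_one, ENNReal.add_halves]
    rw [Set.disjoint_left]
    intro ω h1 h2
    have h1' : ε i ω = 1 := h1
    have h2' : ε i ω = -1 := h2
    linarith
  filter_upwards [ae_all_iff.2 h] with ω hω
  have : ∀ i, ∃ s : ℤˣ, ε i ω = ((s : ℤ) : ℝ) := fun i => by
    rcases hω i with h | h
    · exact ⟨1, by simp [h]⟩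
    · exact ⟨-1, by simp [h]⟩
  choose τ hτ using this
  exact ⟨τ, funext hτ⟩

theorem IsRademacherSeq.measure_eq_signVec (hε : IsRademacherSeq μ ε) (τ : Fin n → ℤˣ) :
    μ ((fun ω i => ε i ω) ⁻¹' {signVec τ}) = (2⁻¹ : ℝ≥0∞) ^ n := by
  have h := hε.indep.measure_inter_preimage_eq_mul Finset.univ
    (sets := fun i => {signVec τ i}) (fun i _ => measurableSet_singleton _)
  have e : (fun ω i => ε i ω) ⁻¹' {signVec τ}
      = ⋂ i ∈ (Finset.univ : Finset (Fin n)), ε i ⁻¹' {signVec τ i} := by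
    ext ω; simp [funext_iff]
  rw [e, h]
  have : ∀ i, μ (ε i ⁻¹' {signVec τ i}) = 2⁻¹ := by
    intro i
    rcases Int.units_eq_one_or (τ i) with h | h
    · simpa [signVec, h, Set.preimage] using hε.prob_one i
    · simpa [signVec, h, Set.preimage] using hε.prob_neg_one i
  simp [this]

open Classical in
/-- An event about the Rademacher signs and the noise is bounded in probability by the
largest proportion of pairs of sign vectors for which it holds, once the absolute values of
the noise are fixed. -/
theorem measure_le_of_card_signs_le [IsProbabilityMeasure μ] (hw : IsSymmetricNoise μ w)
    (hε : IsRademacherSeq μ ε) (hεw : IndepFun (fun ω i => ε i ω) (fun ω i => w i ω) μ)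
    {B : Set ((Fin n → ℝ) × (Fin n → ℝ))} (hB : MeasurableSet B) {c : ℝ}
    (h : ∀ a : Fin n → ℝ, ((Finset.univ.filter fun p : (Fin n → ℤˣ) × (Fin n → ℤˣ) =>
      (signVec p.2, fun i => signVec p.1 i * a i) ∈ B).card : ℝ) ≤ 4 ^ n * c) :
    μ {ω | ((fun i => ε i ω), fun i => w i ω) ∈ B} ≤ ENNReal.ofReal c := by
  set D : (Fin n → ℤˣ) × (Fin n → ℤˣ) → Set Ω := fun p =>
    {ω | (signVec p.2, fun i => signVec p.1 i * w i ω) ∈ B} with hD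
  have hslice : ∀ τ : Fin n → ℤˣ, MeasurableSet {u | (signVec τ, u) ∈ B} := fun τ =>
    measurable_prodMk_left hB
  have hflip : ∀ σ : Fin n → ℤˣ, Measurable fun ω i => signVec σ i * w i ω := fun σ =>
    measurable_pi_iff.2 fun i => (hw.measurable i).const_mul _
  have hDm : ∀ p, MeasurableSet (D p) := fun p => hflip p.1 (hslice p.2)
  have hcardS : (Finset.univ : Finset (Fin n → ℤˣ)).card = 2 ^ n := by simp
  have two_pow : ((2 : ℝ≥0∞) ^ n) * (2⁻¹) ^ n = 1 := by
    rw [← mul_pow, ENNReal.mul_inv_cancel (by simp) (by simp), one_pow]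
  -- Flipping signs preserves the law of the noise, so each probability equals its average over all
  -- flips `σ`.
  have havg : ∀ τ, μ ((fun ω i => w i ω) ⁻¹' {u | (signVec τ, u) ∈ B})
      = (2⁻¹ : ℝ≥0∞) ^ n * ∑ σ, μ (D (σ, τ)) := by
    intro τ
    have : ∀ σ, μ (D (σ, τ)) = μ ((fun ω i => w i ω) ⁻¹' {u | (signVec τ, u) ∈ B}) := fun σ =>
      ((hw.identDistrib_sign_mul σ).measure_mem_eq (hslice τ)).symm
    simp only [this, Finset.sum_const, hcardS, nsmul_eq_mul]
    push_cast
    rw [← mul_assoc, mul_comm (2⁻¹ ^ n), two_pow, one_mul]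
  have h1 : μ {ω | ((fun i => ε i ω), fun i => w i ω) ∈ B} ≤ ∑ τ : Fin n → ℤˣ,
      μ ((fun ω i => ε i ω) ⁻¹' {signVec τ} ∩
        (fun ω i => w i ω) ⁻¹' {u | (signVec τ, u) ∈ B}) := by
    refine le_trans (measure_mono_ae ?_) (measure_biUnion_finset_le Finset.univ _)
    filter_upwards [hε.ae_exists_signVec] with ω ⟨τ, hτ⟩ hω
    have hω' : ((fun i => ε i ω), fun i => w i ω) ∈ B := hω
    rw [hτ] at hω'
    exact Set.mem_iUnion₂.2 ⟨τ, Finset.mem_univ _, hτ, hω'⟩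
  refine h1.trans ?_
  have h2 : ∑ p, μ (D p) ≤ 4 ^ n * ENNReal.ofReal c := by
    have e : ∑ p, μ (D p) = ∫⁻ ω, ∑ p, (D p).indicator 1 ω ∂μ := by
      rw [lintegral_finsetSum _ fun p _ => measurable_one.indicator (hDm p)]
      simp only [lintegral_indicator_one (hDm _)]
    rw [e]
    -- For fixed `ω` the integrand counts sign pairs, so the hypothesis applies with `a = w(ω)`.
    calc _ ≤ ∫⁻ _, 4 ^ n * ENNReal.ofReal c ∂μ := by
          refine lintegral_mono fun ω => ?_
          have := ENNReal.ofReal_le_ofReal (h fun i => w i ω)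
          rw [ENNReal.ofReal_mul (by positivity), ENNReal.ofReal_pow (by norm_num),
            ENNReal.ofReal_natCast] at this
          refine le_trans (le_of_eq ?_) (this.trans_eq (by norm_num))
          simp [hD, Set.indicator_apply]
      _ = _ := by simp
  calc ∑ τ : Fin n → ℤˣ, μ ((fun ω i => ε i ω) ⁻¹' {signVec τ} ∩
        (fun ω i => w i ω) ⁻¹' {u | (signVec τ, u) ∈ B})
      = ∑ τ : Fin n → ℤˣ, (2⁻¹ : ℝ≥0∞) ^ n * ((2⁻¹ : ℝ≥0∞) ^ n * ∑ σ, μ (D (σ, τ))) := by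
        refine Finset.sum_congr rfl fun τ _ => ?_
        rw [hεw.measure_inter_preimage_eq_mul _ _ (measurableSet_singleton _) (hslice τ),
          hε.measure_eq_signVec, havg]
    _ = (4⁻¹ : ℝ≥0∞) ^ n * ∑ p, μ (D p) := by
        rw [Fintype.sum_prod_type_right, Finset.mul_sum]
        refine Finset.sum_congr rfl fun τ _ => ?_
        rw [← mul_assoc, ← mul_pow, ← ENNReal.mul_inv (by simp) (by simp)]
        norm_num
    _ ≤ (4⁻¹ : ℝ≥0∞) ^ n * (4 ^ n * ENNReal.ofReal c) := by gcongr
    _ = ENNReal.ofReal c := by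
        rw [← mul_assoc, ← mul_pow, ENNReal.inv_mul_cancel (by simp) (by simp), one_pow, one_mul]

end WildRefit

/-! ### Empirical geometry and localized suprema -/

namespace WildRefit

variable {X : Type*} {n : ℕ} {x : Fin n → X}

theorem empNorm_nonneg (g : X → ℝ) : 0 ≤ empNorm x g := Real.sqrt_nonneg _

theorem empNorm_sq (g : X → ℝ) : empNorm x g ^ 2 = 1 / (n : ℝ) * ∑ i, g (x i) ^ 2 :=
  Real.sq_sqrt (by positivity)

theorem empNorm_eq_norm (g : X → ℝ) :
    empNorm x g = Real.sqrt (1 / (n : ℝ)) * ‖WithLp.toLp 2 (evalVec x g)‖ := by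
  rw [EuclideanSpace.norm_eq, empNorm, Real.sqrt_mul (by positivity)]
  simp [evalVec]

theorem empNorm_add_le (g h : X → ℝ) : empNorm x (g + h) ≤ empNorm x g + empNorm x h := by
  have e : WithLp.toLp 2 (evalVec x (g + h))
      = WithLp.toLp 2 (evalVec x g) + WithLp.toLp 2 (evalVec x h) := rfl
  simp only [empNorm_eq_norm, ← mul_add, e]
  exact mul_le_mul_of_nonneg_left (norm_add_le _ _) (Real.sqrt_nonneg _)

theorem empNorm_smul {a : ℝ} (ha : 0 ≤ a) (g : X → ℝ) : empNorm x (a • g) = a * empNorm x g := by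
  have e : WithLp.toLp 2 (evalVec x (a • g)) = a • WithLp.toLp 2 (evalVec x g) := rfl
  rw [empNorm_eq_norm, empNorm_eq_norm, e, norm_smul, Real.norm_of_nonneg ha]
  ring

theorem empNorm_sub_comm (g h : X → ℝ) : empNorm x (g - h) = empNorm x (h - g) := by
  simp only [empNorm, Pi.sub_apply]
  congr 2
  exact Finset.sum_congr rfl fun i _ => by ring

theorem empInner_add_left (u v : Fin n → ℝ) (g : X → ℝ) :
    empInner x (u + v) g = empInner x u g + empInner x v g := by
  simp only [empInner, Pi.add_apply, add_mul, Finset.sum_add_distrib, mul_add]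

theorem empInner_add_right (u : Fin n → ℝ) (g h : X → ℝ) :
    empInner x u (g + h) = empInner x u g + empInner x u h := by
  simp only [empInner, Pi.add_apply, mul_add, Finset.sum_add_distrib]

theorem empInner_smul_right (u : Fin n → ℝ) (a : ℝ) (g : X → ℝ) :
    empInner x u (a • g) = a * empInner x u g := by
  simp only [empInner, Pi.smul_apply, smul_eq_mul, Finset.mul_sum]
  exact Finset.sum_congr rfl fun i _ => by ring

theorem empInner_le (u : Fin n → ℝ) (g : X → ℝ) :
    empInner x u g ≤ 1 / (n : ℝ) * ∑ i, u i ^ 2 + empNorm x g ^ 2 := by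
  rw [empNorm_sq, empInner, ← mul_add, ← Finset.sum_add_distrib]
  refine mul_le_mul_of_nonneg_left (Finset.sum_le_sum fun i _ => ?_) (by positivity)
  nlinarith [sq_nonneg (u i - g (x i)), sq_nonneg (u i), sq_nonneg (g (x i))]

theorem mem_empBall_self {F : Set (X → ℝ)} {g : X → ℝ} (hg : g ∈ F) {r : ℝ} (hr : 0 ≤ r) :
    g ∈ empBall x F g r := ⟨hg, by simpa [empNorm] using hr⟩

/-- Guards against the default value `0` of `sSup` on unbounded sets of reals. -/
theorem bddAbove_empInner_empBall (F : Set (X → ℝ)) (g : X → ℝ) (u : Fin n → ℝ) (r : ℝ) :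
    BddAbove ((fun f : X → ℝ => empInner x u (f - g)) '' empBall x F g r) := by
  refine ⟨1 / (n : ℝ) * ∑ i, u i ^ 2 + r ^ 2, ?_⟩
  rintro _ ⟨f, hf, rfl⟩
  have h1 := empInner_le (x := x) u (f - g)
  have h2 := pow_le_pow_left₀ (empNorm_nonneg _) hf.2 2
  dsimp only
  linarith

theorem le_localComplexity {F : Set (X → ℝ)} {g f : X → ℝ} {r : ℝ} (e v : Fin n → ℝ)
    (hf : f ∈ empBall x F g r) :
    empInner x (fun i => e i * v i) (f - g) ≤ localComplexity x F g e v r :=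
  le_csSup (bddAbove_empInner_empBall F g _ r) ⟨f, hf, rfl⟩

theorem localComplexity_nonneg {F : Set (X → ℝ)} {g : X → ℝ} (hg : g ∈ F) {r : ℝ} (hr : 0 ≤ r)
    (e v : Fin n → ℝ) : 0 ≤ localComplexity x F g e v r := by
  simpa [empInner] using le_localComplexity e v (mem_empBall_self (x := x) hg hr)

theorem localComplexity_le {F : Set (X → ℝ)} {g : X → ℝ} (hg : g ∈ F) {r : ℝ} (hr : 0 ≤ r)
    {e v : Fin n → ℝ} {c : ℝ}
    (h : ∀ f ∈ empBall x F g r, empInner x (fun i => e i * v i) (f - g) ≤ c) :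
    localComplexity x F g e v r ≤ c := by
  refine csSup_le ⟨_, g, mem_empBall_self hg hr, rfl⟩ ?_
  rintro _ ⟨f, hf, rfl⟩
  exact h f hf

theorem localComplexity_eq_iSup (F : Set (X → ℝ)) (g : X → ℝ) (e v : Fin n → ℝ) (r : ℝ) :
    localComplexity x F g e v r
      = ⨆ f : empBall x F g r, empInner x (fun i => e i * v i) (f - g) :=
  sSup_image'

/-- The ball may be uncountable, but a pointwise bounded supremum of continuous functions is lower
semicontinuous. -/
theorem measurable_localComplexity (F : Set (X → ℝ)) (g : X → ℝ) (r : ℝ) :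
    Measurable fun p : (Fin n → ℝ) × (Fin n → ℝ) => localComplexity x F g p.1 p.2 r := by
  simp only [localComplexity_eq_iSup]
  refine (lowerSemicontinuous_ciSup (fun p => ?_) fun f => ?_).measurable
  · have := bddAbove_empInner_empBall (x := x) F g (fun i => p.1 i * p.2 i) r
    rwa [Set.image_eq_range] at this
  · refine Continuous.lowerSemicontinuous ?_
    unfold empInner
    fun_prop

theorem measurable_localComplexity_comp {α : Type*} [MeasurableSpace α] (F : Set (X → ℝ))
    (g : X → ℝ) (r : ℝ) {e v : α → Fin n → ℝ} (he : Measurable e) (hv : Measurable v) :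
    Measurable fun a => localComplexity x F g (e a) (v a) r := by
  have := (measurable_localComplexity (x := x) F g r).comp (he.prodMk hv)
  exact this

/-- In a convex class the localized supremum grows at most linearly with the radius. -/
theorem localComplexity_le_mul_of_convex {F : Set (X → ℝ)} (hF : Convex ℝ F) {g : X → ℝ}
    (hg : g ∈ F) (e v : Fin n → ℝ) {r s : ℝ} (hr : 0 < r) (hrs : r ≤ s) :
    localComplexity x F g e v s ≤ s / r * localComplexity x F g e v r := by
  have hs : 0 < s := hr.trans_le hrs
  refine localComplexity_le hg hs.le fun f hf => ?_
  have ha0 : 0 ≤ r / s := by positivity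
  have ha1 : r / s ≤ 1 := (div_le_one hs).2 hrs
  have e1 : g + (r / s) • (f - g) - g = (r / s) • (f - g) := by abel
  -- Shrinking towards the centre stays in `F` by convexity and scales the linear functional by `r /
  -- s`.
  have hmem : g + (r / s) • (f - g) ∈ empBall x F g r := by
    refine ⟨hF.add_smul_sub_mem hg hf.1 ⟨ha0, ha1⟩, ?_⟩
    rw [e1, empNorm_smul ha0]
    calc r / s * empNorm x (f - g) ≤ r / s * s := mul_le_mul_of_nonneg_left hf.2 ha0
      _ = r := by field_simp
  have h1 := le_localComplexity e v hmem
  rw [e1, empInner_smul_right] at h1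
  calc empInner x (fun i => e i * v i) (f - g)
      = s / r * (r / s * empInner x (fun i => e i * v i) (f - g)) := by field_simp
    _ ≤ _ := mul_le_mul_of_nonneg_left h1 (by positivity)

/-- Supplies the Lipschitz constant `‖a‖ * r / √n` of the Rademacher processes below. -/
theorem sum_sq_mul_le (a : Fin n → ℝ) (h : X → ℝ) {r : ℝ} (hr : empNorm x h ≤ r) :
    ∑ j, (1 / (n : ℝ) * (a j * h (x j))) ^ 2 ≤ (‖a‖ * r / Real.sqrt n) ^ 2 := by
  have h1 : ∀ j, (1 / (n : ℝ) * (a j * h (x j))) ^ 2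
      ≤ ‖a‖ ^ 2 / n * (1 / (n : ℝ) * h (x j) ^ 2) := by
    intro j
    have : a j ^ 2 ≤ ‖a‖ ^ 2 := by
      rw [← sq_abs]
      exact pow_le_pow_left₀ (abs_nonneg _) (norm_le_pi_norm a j) 2
    calc (1 / (n : ℝ) * (a j * h (x j))) ^ 2
        = (1 / (n : ℝ)) ^ 2 * h (x j) ^ 2 * a j ^ 2 := by ring
      _ ≤ (1 / (n : ℝ)) ^ 2 * h (x j) ^ 2 * ‖a‖ ^ 2 := by gcongr
      _ = _ := by ring
  refine (Finset.sum_le_sum fun j _ => h1 j).trans ?_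
  rw [← Finset.mul_sum, ← Finset.mul_sum, ← empNorm_sq, div_pow, mul_pow,
    Real.sq_sqrt (Nat.cast_nonneg n)]
  have := pow_le_pow_left₀ (empNorm_nonneg _) hr 2
  calc ‖a‖ ^ 2 / n * empNorm x h ^ 2 ≤ ‖a‖ ^ 2 / n * r ^ 2 := by gcongr
    _ = _ := by ring

theorem norm_signVec_mul (σ : Fin n → ℤˣ) (a : Fin n → ℝ) :
    ‖(fun i => signVec σ i * a i)‖ = ‖a‖ := by
  have : ∀ i, ‖signVec σ i * a i‖ = ‖a i‖ := fun i => by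
    rcases Int.units_eq_one_or (σ i) with h | h <;> simp [signVec, h]
  simp only [Pi.norm_def, nnnorm, this]

/-! ### Deviation bounds for the noise and wild processes -/

section Probability

variable {Ω : Type*} [MeasurableSpace Ω] {μ : Measure Ω} [IsProbabilityMeasure μ]
  {w ε : Fin n → Ω → ℝ}

/-- Comparison of the localized supremum of the noise process with its wild version. -/
theorem measure_localComplexity_deviation_le (hw : IsSymmetricNoise μ w)
    (hε : IsRademacherSeq μ ε) (hεw : IndepFun (fun ω i => ε i ω) (fun ω i => w i ω) μ)
    {F : Set (X → ℝ)} {g : X → ℝ} (hg : g ∈ F) {r q : ℝ} (hr : 0 ≤ r) (hq : 0 < q) :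
    μ {ω | localComplexity x F g (fun i => ε i ω) (fun i => w i ω) r
        + q * (‖(fun i => w i ω : Fin n → ℝ)‖ * r / Real.sqrt n)
        < localComplexity x F g 1 (fun i => w i ω) r}
      ≤ ENNReal.ofReal (Real.exp (-(q ^ 2 / 8))) := by
  classical
  refine measure_le_of_card_signs_le hw hε hεw
    (B := {p | localComplexity x F g p.1 p.2 r + q * (‖p.2‖ * r / Real.sqrt n)
      < localComplexity x F g 1 p.2 r}) ?_ ?_
  · have h1 := measurable_localComplexity (x := x) F g r
    have h2 : Measurable fun p : (Fin n → ℝ) × (Fin n → ℝ) => q * (‖p.2‖ * r / Real.sqrt n) := by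
      fun_prop
    have h4 : Measurable fun p : (Fin n → ℝ) × (Fin n → ℝ) => localComplexity x F g 1 p.2 r :=
      measurable_localComplexity_comp F g r measurable_const measurable_snd
    have h5 : Measurable fun p : (Fin n → ℝ) × (Fin n → ℝ) => localComplexity x F g p.1 p.2 r
      + q * (‖p.2‖ * r / Real.sqrt n) := h1.add h2
    exact measurableSet_lt h5 h4
  · intro a
    have : Nonempty (empBall x F g r) := ⟨g, mem_empBall_self hg hr⟩
    set v : empBall x F g r → Fin n → ℝ :=
      fun f j => 1 / (n : ℝ) * (a j * (f.1 - g) (x j)) with hv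
    have hL : 0 ≤ ‖a‖ * r / Real.sqrt n := by positivity
    have hdev := card_iSup_deviation_le v hL hq (fun f => sum_sq_mul_le a _ f.2.2)
      (fun p => (⨆ f, ∑ j, signVec p.2 j * v f j) + q * (‖a‖ * r / Real.sqrt n)
        < ⨆ f, ∑ j, signVec p.1 j * v f j) (fun p hp => hp)
    refine le_trans ?_ hdev
    have e1 : ∀ σ : Fin n → ℤˣ, localComplexity x F g 1 (fun i => signVec σ i * a i) r
        = ⨆ f, ∑ j, signVec σ j * v f j := by
      intro σ
      rw [localComplexity_eq_iSup]
      refine iSup_congr fun f => ?_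
      simp only [empInner, Finset.mul_sum, hv]
      exact Finset.sum_congr rfl fun j _ => by simp only [Pi.one_apply]; ring
    have e2 : ∀ σ τ : Fin n → ℤˣ,
        localComplexity x F g (signVec τ) (fun i => signVec σ i * a i) r
        = ⨆ f, ∑ j, signVec (τ * σ) j * v f j := by
      intro σ τ
      rw [localComplexity_eq_iSup]
      refine iSup_congr fun f => ?_
      simp only [empInner, Finset.mul_sum, hv, signVec_mul]
      exact Finset.sum_congr rfl fun j _ => by ring
    -- The wild process has signs `τ * σ`; reparametrizing pairs injectively by `(σ, τ * σ)` turns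
    -- it into the independent copy.
    refine Nat.cast_le.2 (Finset.card_le_card_of_injOn (fun p => (p.1, p.2 * p.1)) ?_ ?_)
    · intro p hp
      have hp' := (Finset.mem_filter.1 hp).2
      simp only [Set.mem_ofPred_eq, norm_signVec_mul, e1, e2] at hp'
      exact Finset.mem_coe.2 (Finset.mem_filter.2 ⟨Finset.mem_univ _, hp'⟩)
    · rintro ⟨σ, τ⟩ - ⟨σ', τ'⟩ - h
      simp only [Prod.mk.injEq] at h ⊢
      obtain ⟨rfl, h⟩ := h
      exact ⟨rfl, mul_right_cancel h⟩

/-- Tail of the wild process at a function that depends on the noise only. -/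
theorem measure_empInner_deviation_le (hw : IsSymmetricNoise μ w)
    (hε : IsRademacherSeq μ ε) (hεw : IndepFun (fun ω i => ε i ω) (fun ω i => w i ω) μ)
    {G : (Fin n → ℝ) → X → ℝ} (hG : ∀ i, Measurable fun u => G u (x i)) {t : ℝ} (ht : 0 < t) :
    μ {ω | 2 * t * (‖(fun i => w i ω : Fin n → ℝ)‖ * empNorm x (G fun i => w i ω) / Real.sqrt n)
        < empInner x (fun i => ε i ω * w i ω) (G fun i => w i ω)}
      ≤ ENNReal.ofReal (Real.exp (-t ^ 2)) := by
  classical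
  refine measure_le_of_card_signs_le hw hε hεw
    (B := {p | 2 * t * (‖p.2‖ * empNorm x (G p.2) / Real.sqrt n)
      < empInner x (fun i => p.1 i * p.2 i) (G p.2)}) ?_ ?_
  · unfold empNorm empInner
    refine measurableSet_lt ?_ ?_ <;> fun_prop
  · intro a
    rw [Finset.card_filter, Fintype.sum_prod_type]
    push_cast
    have hσ : ∀ σ : Fin n → ℤˣ, (∑ τ : Fin n → ℤˣ,
        if (signVec τ, fun i => signVec σ i * a i) ∈
          {p : (Fin n → ℝ) × (Fin n → ℝ) | 2 * t * (‖p.2‖ * empNorm x (G p.2) / Real.sqrt n)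
            < empInner x (fun i => p.1 i * p.2 i) (G p.2)} then (1 : ℝ) else 0)
          ≤ 2 ^ n * Real.exp (-t ^ 2) := by
      -- With `σ` fixed the noise vector `b`, and with it the function `G b`, is frozen; only `τ`
      -- varies, linearly.
      intro σ
      set b : Fin n → ℝ := fun i => signVec σ i * a i
      have := card_signVec_sum_le (fun j => 1 / (n : ℝ) * (b j * G b (x j)))
        (L := ‖b‖ * empNorm x (G b) / Real.sqrt n)
        (div_nonneg (mul_nonneg (norm_nonneg _) (empNorm_nonneg _)) (Real.sqrt_nonneg _)) ht
        (sum_sq_mul_le b _ le_rfl)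
        (fun τ => (signVec τ, b) ∈ {p : (Fin n → ℝ) × (Fin n → ℝ) |
          2 * t * (‖p.2‖ * empNorm x (G p.2) / Real.sqrt n)
            < empInner x (fun i => p.1 i * p.2 i) (G p.2)})
        (fun τ hτ => by
          refine lt_of_lt_of_eq hτ ?_
          simp only [empInner, Finset.mul_sum]
          exact Finset.sum_congr rfl fun j _ => by ring)
      rw [Finset.card_filter] at this
      push_cast at this
      exact this
    refine (Finset.sum_le_sum fun σ _ => hσ σ).trans_eq ?_
    simp only [Finset.sum_const, Finset.card_univ, Fintype.card_pi, Finset.prod_const,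
      nsmul_eq_mul]
    simp only [Fintype.card_units_int, Fintype.card_fin]
    rw [show (4 : ℝ) = 2 * 2 by norm_num, mul_pow]
    push_cast
    ring

end Probability

end WildRefit

/-! ### Peeling and the deterministic comparison -/

namespace WildRefit

/-- The geometric grid of radii used for peeling. -/
noncomputable def peelRadius (n : ℕ) (t : ℝ) (k : ℕ) : ℝ :=
  t ^ 2 / Real.sqrt n * (1 + 1 / t) ^ k

/-- The deviation level, in units of the Lipschitz constant, at the given layer of the grid. -/
noncomputable def peelLevel (t : ℝ) (k : ℕ) : ℝ :=
  4 * t * (1 + 1 / t) ^ k / (1 + 1 / t)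

theorem peelRadius_succ (n : ℕ) (t : ℝ) (k : ℕ) :
    peelRadius n t (k + 1) = (1 + 1 / t) * peelRadius n t k := by
  simp only [peelRadius, pow_succ]; ring

/-- The level is tuned for this identity: the deviation paid at the outer radius of a layer is a
multiple of its inner radius squared, hence at most `4 / t` times the squared error in that layer.
-/
theorem peelLevel_mul_peelRadius {n : ℕ} (hn : 0 < n) {t : ℝ} (ht : 0 < t) (k : ℕ) :
    peelLevel t k * (peelRadius n t (k + 1) / Real.sqrt n) = 4 * peelRadius n t k ^ 2 / t := by
  have hs : 0 < Real.sqrt n := Real.sqrt_pos.2 (Nat.cast_pos.2 hn)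
  have h1 : (0 : ℝ) < 1 + 1 / t := by positivity
  simp only [peelRadius, peelLevel, pow_succ]
  generalize 1 + 1 / t = a at *
  field_simp

theorem exp_neg_peelLevel_le {t : ℝ} (ht : 3 ≤ t) (k : ℕ) :
    Real.exp (-(peelLevel t k ^ 2 / 8)) ≤ Real.exp (-t ^ 2) / 2 / 2 ^ k := by
  have ht0 : 0 < t := by linarith
  have hq : peelLevel t k ^ 2 / 8 = 2 * t ^ 2 * ((1 + 1 / t) ^ k) ^ 2 / (1 + 1 / t) ^ 2 := by
    rw [peelLevel, div_pow]; ring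
  have h1 : (1 + 1 / t) ^ 2 ≤ 16 / 9 := by
    have : 1 / t ≤ 1 / 3 := one_div_le_one_div_of_le (by norm_num) ht
    nlinarith [one_div_pos.2 ht0]
  have hb : 1 + k * (1 / t) ≤ (1 + 1 / t) ^ k :=
    one_add_mul_le_pow (by linarith [one_div_pos.2 ht0]) k
  have hb2 : 1 + 2 * k / t ≤ ((1 + 1 / t) ^ k) ^ 2 := by
    have : 0 ≤ k * (1 / t) := by positivity
    have e : 2 * k / t = 2 * (k * (1 / t)) := by ring
    rw [e]
    nlinarith
  -- The surplus `k + 1` makes the layers summable. With `t ≥ 3`, `2 * t ^ 2 + 4 * t * k` dominates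
  -- `16 / 9 * (t ^ 2 + k + 1)`.
  have h2 : t ^ 2 + (k + 1) ≤ peelLevel t k ^ 2 / 8 := by
    rw [hq, le_div_iff₀ (by positivity)]
    have h3 : 2 * t ^ 2 * (1 + 2 * k / t) ≤ 2 * t ^ 2 * ((1 + 1 / t) ^ k) ^ 2 := by gcongr
    have e : 2 * t ^ 2 * (1 + 2 * k / t) = 2 * t ^ 2 + 4 * t * k := by field_simp; ring
    have h4 : (t ^ 2 + (k + 1)) * (1 + 1 / t) ^ 2 ≤ (t ^ 2 + (k + 1)) * (16 / 9) := by gcongr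
    have hk : (0 : ℝ) ≤ k := Nat.cast_nonneg k
    nlinarith
  have hexp : Real.exp (-((k : ℝ) + 1)) ≤ 1 / 2 / 2 ^ k := by
    have h5 : (2 : ℝ) ≤ Real.exp 1 := by linarith [Real.exp_one_gt_d9]
    have h6 : (2 : ℝ) ^ (k + 1) ≤ Real.exp ((k : ℝ) + 1) := by
      calc (2 : ℝ) ^ (k + 1) ≤ Real.exp 1 ^ (k + 1) := by gcongr
        _ = _ := by rw [← Real.exp_nat_mul]; push_cast; ring_nf
    rw [Real.exp_neg, div_div, ← pow_succ', one_div]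
    exact inv_anti₀ (by positivity) h6
  calc Real.exp (-(peelLevel t k ^ 2 / 8)) ≤ Real.exp (-t ^ 2 + -((k : ℝ) + 1)) :=
        Real.exp_le_exp.2 (by linarith)
    _ = Real.exp (-t ^ 2) * Real.exp (-((k : ℝ) + 1)) := Real.exp_add _ _
    _ ≤ Real.exp (-t ^ 2) * (1 / 2 / 2 ^ k) := by gcongr
    _ = _ := by ring

variable {X : Type*} {n : ℕ} {x : Fin n → X}

/-- The argument for one outcome, with the two probabilistic bounds as hypotheses. `hlarge` places
the error above the smallest grid radius `t ^ 2 / √n`. -/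
theorem sq_estError_le_of_noise_comparison (hn : 0 < n) {F : Set (X → ℝ)}
    {M : (Fin n → ℝ) → X → ℝ} (hMF : ∀ y, M y ∈ F) {fstar : X → ℝ}
    (hfirm : FirmlyNonexpansiveAround x M fstar) {t : ℝ} (ht : 3 ≤ t) {w e y : Fin n → ℝ}
    (hy : y = evalVec x fstar + w) (ftil : X → ℝ)
    (hdev : ∀ k, localComplexity x F (M (evalVec x fstar)) 1 w (peelRadius n t (k + 1)) ≤
      localComplexity x F (M (evalVec x fstar)) e w (peelRadius n t (k + 1))
        + peelLevel t k * (‖w‖ * peelRadius n t (k + 1) / Real.sqrt n))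
    (hcross : empInner x (fun i => e i * w i) (M y - M (evalVec x fstar)) ≤
      2 * t * (‖w‖ * estError x M fstar y / Real.sqrt n))
    (hlarge : t ^ 4 / n < estError x M fstar y ^ 2) :
    estError x M fstar y ^ 2 ≤
      wildComplexity x F y e (M y) ftil ((2 + 1 / t) * estError x M fstar y)
        + 6 * ‖w‖ / t * estError x M fstar y ^ 2
        + pilotError x F fstar e (M y) ftil ((2 + 1 / t) * estError x M fstar y) := by
  have ht0 : 0 < t := by linarith
  have hs : 0 < Real.sqrt n := Real.sqrt_pos.2 (Nat.cast_pos.2 hn)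
  have hr0 : 0 ≤ estError x M fstar y := empNorm_nonneg _
  set R := estError x M fstar y with hR
  set fd := M (evalVec x fstar) with hfd
  have hRt : t ^ 2 / Real.sqrt n ≤ R := by
    refine (abs_le_of_sq_le_sq' ?_ hr0).2
    rw [div_pow, Real.sq_sqrt (Nat.cast_nonneg n)]
    calc (t ^ 2) ^ 2 / n = t ^ 4 / n := by ring
      _ ≤ _ := hlarge.le
  have hbase : 0 < t ^ 2 / Real.sqrt n := by positivity
  -- The layer containing `R`; its outer radius exceeds `R` by at most the factor `1 + 1 / t`.
  obtain ⟨k, hk1, hk2⟩ := exists_nat_pow_near ((one_le_div hbase).2 hRt)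
    (show 1 < 1 + 1 / t by linarith [one_div_pos.2 ht0])
  have hk1' : peelRadius n t k ≤ R := by
    rw [le_div_iff₀ hbase, mul_comm] at hk1; exact hk1
  have hk2' : R ≤ peelRadius n t (k + 1) := by
    rw [div_lt_iff₀ hbase, mul_comm] at hk2; exact hk2.le
  have hpk : 0 ≤ peelRadius n t k := by unfold peelRadius; positivity
  have hpk' : peelRadius n t (k + 1) ≤ (1 + 1 / t) * R := by
    rw [peelRadius_succ]; gcongr
  have h1 : R ^ 2 ≤ localComplexity x F fd 1 w (peelRadius n t (k + 1)) := by
    have h2 := hfirm w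
    rw [← hy] at h2
    refine h2.trans ?_
    have h3 := le_localComplexity (x := x) (F := F) (g := fd) (f := M y)
      (r := peelRadius n t (k + 1)) 1 w ⟨hMF y, hk2'⟩
    simpa only [Pi.one_apply, one_mul] using h3
  have h2 : peelLevel t k * (‖w‖ * peelRadius n t (k + 1) / Real.sqrt n) ≤ 4 * ‖w‖ / t * R ^ 2 := by
    calc peelLevel t k * (‖w‖ * peelRadius n t (k + 1) / Real.sqrt n)
        = ‖w‖ * (peelLevel t k * (peelRadius n t (k + 1) / Real.sqrt n)) := by ring
      _ = ‖w‖ * (4 * peelRadius n t k ^ 2 / t) := by rw [peelLevel_mul_peelRadius hn ht0]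
      _ ≤ ‖w‖ * (4 * R ^ 2 / t) := by gcongr
      _ = _ := by ring
  have h3 : 2 * t * (‖w‖ * R / Real.sqrt n) ≤ 2 * ‖w‖ / t * R ^ 2 := by
    calc 2 * t * (‖w‖ * R / Real.sqrt n) = 2 * ‖w‖ / t * R * (t ^ 2 / Real.sqrt n) := by
          field_simp
      _ ≤ 2 * ‖w‖ / t * R * R := by gcongr
      _ = _ := by ring
  have h4 : localComplexity x F fd e w (peelRadius n t (k + 1)) ≤
      wildComplexity x F y e (M y) ftil ((2 + 1 / t) * R)
        + pilotError x F fstar e (M y) ftil ((2 + 1 / t) * R)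
        + 2 * t * (‖w‖ * R / Real.sqrt n) := by
    refine localComplexity_le (hMF _) (hr0.trans hk2') fun f hf => ?_
    have hmem : f ∈ empBall x F (M y) ((2 + 1 / t) * R) := by
      refine ⟨hf.1, ?_⟩
      have e1 : f - M y = (f - fd) + (fd - M y) := by abel
      rw [e1]
      refine (empNorm_add_le _ _).trans ?_
      have e2 : empNorm x (fd - M y) = R := empNorm_sub_comm _ _
      rw [e2]
      linarith [hf.2]
    -- Recentring leaves the cross term with `M y - fd`, and `e4` splits the noise into pilot
    -- residual and pilot error.
    have e3 : f - fd = (f - M y) + (M y - fd) := by abel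
    have e4 : (fun i => e i * w i) = (fun i => e i * (y - evalVec x ftil) i)
        + fun i => e i * evalVec x (ftil - fstar) i := by
      funext i
      simp only [hy, evalVec, Pi.add_apply, Pi.sub_apply]
      ring
    have hW := le_localComplexity e (y - evalVec x ftil) hmem
    have hA := le_localComplexity e (evalVec x (ftil - fstar)) hmem
    have e5 : empInner x (fun i => e i * w i) (f - M y)
        = empInner x (fun i => e i * (y - evalVec x ftil) i) (f - M y)
          + empInner x (fun i => e i * evalVec x (ftil - fstar) i) (f - M y) := by
      rw [e4, empInner_add_left]
    rw [e3, empInner_add_right, e5]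
    exact add_le_add (add_le_add hW hA) hcross
  have h5 := hdev k
  have e6 : 6 * ‖w‖ / t * R ^ 2 = 4 * ‖w‖ / t * R ^ 2 + 2 * ‖w‖ / t * R ^ 2 := by ring
  linarith

end WildRefit

/-! ### The good event and the two bounds -/

theorem theorem2 {X : Type*} {n : ℕ} (hn : 0 < n) (x : Fin n → X)
    (F : Set (X → ℝ)) (C : Set (Fin n → ℝ)) (hC : IsCompact C)
    (M : (Fin n → ℝ) → (X → ℝ))
    (hM : WildRefit.IsMEstimator x F (WildRefit.constraintPenalty x C) M)
    (hMmeas : ∀ i, Measurable fun y => M y (x i))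
    (fstar : X → ℝ) (hfirm : WildRefit.FirmlyNonexpansiveAround x M fstar)
    {Ω : Type*} [MeasurableSpace Ω] (μ : Measure Ω) [IsProbabilityMeasure μ]
    (w ε : Fin n → Ω → ℝ)
    (hw : WildRefit.IsSymmetricNoise μ w) (hε : WildRefit.IsRademacherSeq μ ε)
    (hεw : IndepFun (fun ω i => ε i ω) (fun ω i => w i ω) μ)
    (y : Ω → Fin n → ℝ) (hy : ∀ ω i, y ω i = fstar (x i) + w i ω)
    (ftil : Ω → X → ℝ) (t : ℝ) (ht : 3 ≤ t) :
    ∃ E : Set Ω, MeasurableSet E ∧ ENNReal.ofReal (1 - 2 * Real.exp (-t ^ 2)) ≤ μ E ∧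
      ∀ ω ∈ E,
        let rhat : ℝ := WildRefit.estError x M fstar (y ω)
        let W : ℝ → ℝ :=
          WildRefit.wildComplexity x F (y ω) (fun i => ε i ω) (M (y ω)) (ftil ω)
        let A : ℝ :=
          WildRefit.pilotError x F fstar (fun i => ε i ω) (M (y ω)) (ftil ω)
            ((2 + 1 / t) * rhat)
        let winf : ℝ := ‖(fun i => w i ω : Fin n → ℝ)‖
        rhat ^ 2 ≤ max (W ((2 + 1 / t) * rhat)) (t ^ 4 / n)
            + 6 * winf / t * rhat ^ 2 + A ∧
        (Convex ℝ F → ∀ ρ : ℝ, 0 < ρ →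
          let rwild : ℝ := WildRefit.wildError x M (y ω) (fun i => ε i ω) (ftil ω) ρ
          0 < rwild →
            rhat ^ 2 ≤ max (max (rwild ^ 2) (rhat / rwild * W ((2 + 1 / t) * rwild)))
                (t ^ 4 / n) + 6 * winf / t * rhat ^ 2 + A) := by
  have ht0 : 0 < t := by linarith
  have hMF : ∀ y, M y ∈ F := fun y => (hM y).1
  have hwm : Measurable fun ω i => w i ω := measurable_pi_iff.2 hw.measurable
  have hεm : Measurable fun ω i => ε i ω := measurable_pi_iff.2 hε.measurable
  set fd := M (WildRefit.evalVec x fstar) with hfd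
  set G : (Fin n → ℝ) → X → ℝ := fun u => M (WildRefit.evalVec x fstar + u) - fd with hG
  have hGm : ∀ i, Measurable fun u => G u (x i) := fun i =>
    ((hMmeas i).comp (measurable_const_add _)).sub_const _
  -- The bad events are centred at the deterministic `fd` and do not involve the pilot, so the pilot
  -- may depend on the data and the signs in any way.
  set D : ℕ → Set Ω := fun k => {ω |
    WildRefit.localComplexity x F fd (fun i => ε i ω) (fun i => w i ω)
        (WildRefit.peelRadius n t (k + 1))
      + WildRefit.peelLevel t k * (‖(fun i => w i ω : Fin n → ℝ)‖
        * WildRefit.peelRadius n t (k + 1) / Real.sqrt n)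
      < WildRefit.localComplexity x F fd 1 (fun i => w i ω)
        (WildRefit.peelRadius n t (k + 1))} with hD
  set H : Set Ω := {ω | 2 * t * (‖(fun i => w i ω : Fin n → ℝ)‖
      * WildRefit.empNorm x (G fun i => w i ω) / Real.sqrt n)
      < WildRefit.empInner x (fun i => ε i ω * w i ω) (G fun i => w i ω)} with hH
  have hDm : ∀ k, MeasurableSet (D k) := fun k => by
    have h1 := WildRefit.measurable_localComplexity_comp (x := x) F fd
      (WildRefit.peelRadius n t (k + 1)) hεm hwm
    have h2 := WildRefit.measurable_localComplexity_comp (x := x) F fd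
      (WildRefit.peelRadius n t (k + 1)) (measurable_const (a := (1 : Fin n → ℝ))) hwm
    have h3 : Measurable fun ω => WildRefit.peelLevel t k * (‖(fun i => w i ω : Fin n → ℝ)‖
        * WildRefit.peelRadius n t (k + 1) / Real.sqrt n) :=
      ((hwm.norm.mul_const _).div_const _).const_mul _
    exact measurableSet_lt (h1.add h3) h2
  have hHm : MeasurableSet H := by
    have h1 : ∀ i, Measurable fun ω => G (fun i => w i ω) (x i) := fun i => (hGm i).comp hwm
    have h2 := hw.measurable
    have h3 := hε.measurable
    have h4 : Measurable fun ω => ‖(fun i => w i ω : Fin n → ℝ)‖ := hwm.norm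
    refine measurableSet_lt ?_ ?_
    · unfold WildRefit.empNorm
      fun_prop
    · unfold WildRefit.empInner
      fun_prop
  have hDμ : μ (⋃ k, D k) ≤ ENNReal.ofReal (Real.exp (-t ^ 2)) := by
    have hsum := hasSum_geometric_two' (Real.exp (-t ^ 2))
    calc μ (⋃ k, D k) ≤ ∑' k, μ (D k) := measure_iUnion_le _
      _ ≤ ∑' k : ℕ, ENNReal.ofReal (Real.exp (-t ^ 2) / 2 / 2 ^ k) := by
          refine ENNReal.tsum_le_tsum fun k => ?_
          refine (WildRefit.measure_localComplexity_deviation_le hw hε hεw (hMF _) ?_ ?_).trans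
            (ENNReal.ofReal_le_ofReal (WildRefit.exp_neg_peelLevel_le ht k))
          · unfold WildRefit.peelRadius; positivity
          · unfold WildRefit.peelLevel; positivity
      _ = ENNReal.ofReal (Real.exp (-t ^ 2)) := by
          rw [← ENNReal.ofReal_tsum_of_nonneg (fun k => by positivity) hsum.summable,
            hsum.tsum_eq]
  have hHμ : μ H ≤ ENNReal.ofReal (Real.exp (-t ^ 2)) :=
    WildRefit.measure_empInner_deviation_le hw hε hεw hGm ht0
  have hbadm : MeasurableSet ((⋃ k, D k) ∪ H) := (MeasurableSet.iUnion hDm).union hHm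
  refine ⟨((⋃ k, D k) ∪ H)ᶜ, hbadm.compl, ?_, ?_⟩
  · rw [prob_compl_eq_one_sub hbadm, ENNReal.ofReal_sub _ (by positivity), ENNReal.ofReal_one,
      two_mul, ENNReal.ofReal_add (Real.exp_pos _).le (Real.exp_pos _).le]
    exact tsub_le_tsub_left ((measure_union_le _ _).trans (add_le_add hDμ hHμ)) 1
  intro ω hω rhat W A winf
  have hyω : y ω = WildRefit.evalVec x fstar + fun i => w i ω := funext fun i => hy ω i
  have hr0 : 0 ≤ rhat := WildRefit.empNorm_nonneg _
  have hA0 : 0 ≤ A := WildRefit.localComplexity_nonneg (hMF _) (by positivity) _ _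
  have hw0 : 0 ≤ 6 * winf / t * rhat ^ 2 := by positivity
  have hmain : t ^ 4 / n < rhat ^ 2 →
      rhat ^ 2 ≤ W ((2 + 1 / t) * rhat) + 6 * winf / t * rhat ^ 2 + A := by
    refine WildRefit.sq_estError_le_of_noise_comparison hn hMF hfirm ht hyω (ftil ω)
      (fun k => not_lt.1 fun h => hω (Or.inl (Set.mem_iUnion.2 ⟨k, h⟩))) ?_
    rw [WildRefit.estError, hyω]
    exact not_lt.1 fun h => hω (Or.inr h)
  -- Below the grid, the term `t ^ 4 / n` suffices, since the remaining summands are nonnegative.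
  rcases le_or_gt (rhat ^ 2) (t ^ 4 / n) with hsmall | hlarge
  · constructor
    · linarith [le_max_right (W ((2 + 1 / t) * rhat)) (t ^ 4 / n)]
    · intro _ ρ _ rwild _
      linarith [le_max_right (max (rwild ^ 2) (rhat / rwild * W ((2 + 1 / t) * rwild)))
        (t ^ 4 / n)]
  have hm := hmain hlarge
  constructor
  · linarith [le_max_left (W ((2 + 1 / t) * rhat)) (t ^ 4 / n)]
  intro hF ρ _ rwild hrw
  have hmax := le_max_left (max (rwild ^ 2) (rhat / rwild * W ((2 + 1 / t) * rwild)))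
    (t ^ 4 / n)
  -- If `rwild` is the larger, its square suffices; otherwise convexity rescales `W` from radius
  -- `rhat` to `rwild`.
  rcases le_total rhat rwild with hle | hle
  · have h1 : rhat ^ 2 ≤ rwild ^ 2 := pow_le_pow_left₀ hr0 hle 2
    linarith [le_max_left (rwild ^ 2) (rhat / rwild * W ((2 + 1 / t) * rwild))]
  · have h2 : (0 : ℝ) < 2 + 1 / t := by positivity
    have h1 : W ((2 + 1 / t) * rhat) ≤
        ((2 + 1 / t) * rhat) / ((2 + 1 / t) * rwild) * W ((2 + 1 / t) * rwild) :=
      WildRefit.localComplexity_le_mul_of_convex hF (hMF _) _ _ (mul_pos h2 hrw)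
        (mul_le_mul_of_nonneg_left hle h2.le)
    rw [mul_div_mul_left _ _ h2.ne'] at h1
    linarith [le_max_right (rwild ^ 2) (rhat / rwild * W ((2 + 1 / t) * rwild))]
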